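/- Let $(M,g)$ be a compact Riemannian manifold (smooth, without boundary) of dimension $n\ge 1$, let $C>0$, and let $B^*M=\{(q,p)\in T^*M:\ \|p\|\le C\}$, with boundary $\partial B^*M=\{\|p\|=C\}$, fibers $\Delta_q=B^*_qM$ and boundary spheres $\partial\Delta_q$. Let $\pi:T^*M\to M$ be the projection. A *symplectic twist map* of $B^*M$ is a diffeomorphism $F$ of $B^*M$ onto itself such that $F^*p\,dq-p\,dq=dS$ for some smooth real function $S$ on $B^*M$, and such that, writing $F(q,p)=(Q,P)$, the map $\psi:(q,p)\mapsto(q,Q)$ is an embedding of $B^*M$ in $M\times M$. Viewed through $\psi$ as a function $S(q,Q)$ on $\psi(B^*M)$, $S$ is called a generating function of $F$. For $q\in M$, a trivializing neighborhood is the part $E$ of $B^*M$ over an open set $V\ni q$ homeomorphic to $\mathbb R^n$, with a trivialization $E\cong V\times B^n$ which takes $\partial E=E\cap\partial B^*M$ to $V\times S^{n-1}$. One has $$H_{n-1}(\partial E\setminus\partial\Delta_q)\cong H_{n-1}\big((\mathbb R^n\setminus\{0\})\times S^{n-1}\big),$$ whose component in $H_{n-1}(\mathbb R^n\setminus\{0\})$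 is given by the first projection (homology is singular, with integer coefficients, and reduced if $n=1$). The spheres $\partial\Delta_q$ and $F(\partial\Delta_q)$ *link* if they are disjoint and if, for some trivializing neighborhood $E$ which contains $\Delta_q$ and $F(\Delta_q)$, the class $[F(\partial\Delta_q)]\in H_{n-1}(\partial E\setminus\partial\Delta_q)$ has a nonzero component in $H_{n-1}(\mathbb R^n\setminus\{0\})$. **Theorem.** Let $F$ be a symplectic twist map of $B^*M$ with generating function $S(q,Q)$, such that for every $q\in M$ the sphere $\partial\Delta_q$ links with its image $F(\partial\Delta_q)$. Then the diagonal of $M\times M$ lies in $\psi(B^*M)$, so that $q\mapsto S(q,q)$ is defined on all of $M$; this function is smooth; and $\pi$ restricts to a bijection from the set of fixed points of $F$ in $B^*M$ onto the set of critical points of $q\mapsto S(q,q)$. -/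

import Mathlib

open Set Bundle CategoryTheory
open scoped Manifold ContDiff

universe u

noncomputable section

namespace TwistMap

/-! ### The cotangent bundle and its disk bundle -/

/-- The model space `ℝⁿ`. -/
abbrev Eucl (n : ℕ) : Type := EuclideanSpace ℝ (Fin n)

/-- The (total space of the) cotangent bundle `T*M`: pairs `(q, p)` with `p ∈ T*_q M`. -/
abbrev Cotangent (n : ℕ) (M : Type u) [TopologicalSpace M] [ChartedSpace (Eucl n) M]
    [IsManifold (𝓡 n) ∞ M] : Type u :=
  TotalSpace (Eucl n →L[ℝ] ℝ)
    (fun q : M => TangentSpace (𝓡 n) q →L[ℝ] Bundle.Trivial M ℝ q)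

/-- The model with corners of `T*M`. -/
abbrev cotModel (n : ℕ) := (𝓡 n).prod 𝓘(ℝ, Eucl n →L[ℝ] ℝ)

/-- A smooth Riemannian metric on `M`. -/
abbrev RiemMetric (n : ℕ) (M : Type u) [TopologicalSpace M] [ChartedSpace (Eucl n) M]
    [IsManifold (𝓡 n) ∞ M] : Type u :=
  ContMDiffRiemannianMetric (𝓡 n) ∞ (Eucl n) (fun q : M => TangentSpace (𝓡 n) q)

variable {n : ℕ} {M : Type u} [TopologicalSpace M] [ChartedSpace (Eucl n) M]
  [IsManifold (𝓡 n) ∞ M]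

/-- The canonical projection `π : T*M → M`. -/
def proj (x : Cotangent n M) : M := x.proj

/-- The covector `p` of a point `x = (q, p)` of `T*M`. -/
def covector (x : Cotangent n M) : TangentSpace (𝓡 n) (proj x) →L[ℝ] ℝ := x.snd

/-- The disk bundle `B*M = {(q, p) | ‖p‖ ≤ C}`. The norm of a covector is that of the tangent
vector `v` which represents it, `p = g(v, ·)`. -/
def diskBundle (g : RiemMetric n M) (C : ℝ) : Set (Cotangent n M) :=
  {x | ∃ v : TangentSpace (𝓡 n) (proj x),
    covector x = g.inner (proj x) v ∧ g.inner (proj x) v v ≤ C ^ 2}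

/-- Its boundary, the sphere bundle `∂B*M = {(q, p) | ‖p‖ = C}`. -/
def sphereBundle (g : RiemMetric n M) (C : ℝ) : Set (Cotangent n M) :=
  {x | ∃ v : TangentSpace (𝓡 n) (proj x),
    covector x = g.inner (proj x) v ∧ g.inner (proj x) v v = C ^ 2}

/-- The fiber `Δ_q` of `B*M` over `q`. -/
def diskFiber (g : RiemMetric n M) (C : ℝ) (q : M) : Set (Cotangent n M) :=
  {x | x ∈ diskBundle g C ∧ proj x = q}

/-- The sphere `∂Δ_q`. -/
def sphereFiber (g : RiemMetric n M) (C : ℝ) (q : M) : Set (Cotangent n M) :=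
  {x | x ∈ sphereBundle g C ∧ proj x = q}

/-! ### Symplectic twist maps -/

/-- The canonical one-form `p dq` on `T*M`: at `x = (q, p)` it sends `ξ` to `p (dπ ξ)`. -/
def canonicalForm (x : Cotangent n M) : TangentSpace (cotModel n) x →L[ℝ] ℝ :=
  (covector x).comp (mfderiv (cotModel n) (𝓡 n) (proj : Cotangent n M → M) x)

/-- `F^* p dq - p dq = dS` on `U`, for a smooth function `S` on `U`. -/
def IsPrimitive (F : Cotangent n M → Cotangent n M) (U : Set (Cotangent n M))
    (S : Cotangent n M → ℝ) : Prop :=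
  ContMDiffOn (cotModel n) 𝓘(ℝ, ℝ) ∞ S U ∧
  ∀ x ∈ U, ∀ ξ : TangentSpace (cotModel n) x,
    canonicalForm (F x) (mfderivWithin (cotModel n) (cotModel n) F U x ξ) - canonicalForm x ξ
      = mfderivWithin (cotModel n) 𝓘(ℝ, ℝ) S U x ξ

/-- The map `ψ : (q, p) ↦ (q, Q)`, where `F (q, p) = (Q, P)`. -/
def psi (F : Cotangent n M → Cotangent n M) (x : Cotangent n M) : M × M :=
  (proj x, proj (F x))

/-- `F` restricts to a symplectic twist map of `U`; its values off `U` play no role. -/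
structure IsSymplecticTwistMap (F : Cotangent n M → Cotangent n M)
    (U : Set (Cotangent n M)) : Prop where
  /-- `F` is a smooth map of `U` onto itself with a smooth inverse. -/
  mapsTo : MapsTo F U U
  contMDiffOn : ContMDiffOn (cotModel n) (cotModel n) ∞ F U
  exists_inverse : ∃ G : Cotangent n M → Cotangent n M,
    MapsTo G U U ∧ InvOn G F U U ∧ ContMDiffOn (cotModel n) (cotModel n) ∞ G U
  /-- `F` is exact symplectic. -/
  exact_symplectic : ∃ S : Cotangent n M → ℝ, IsPrimitive F U S
  /-- Twist condition: `ψ` is an embedding of `U` in `M × M` (a topological embedding, and an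
  immersion). -/
  isEmbedding_psi : Topology.IsEmbedding (U.domRestrict (psi F))
  immersion_psi : ∀ x ∈ U, Function.Injective
    (mfderivWithin (cotModel n) ((𝓡 n).prod (𝓡 n)) (psi F) U x)

/-- `S(q, Q)` is a generating function of `F`: as a function of `(q, p)`, through `ψ`, it is a
primitive of `F^* p dq - p dq` on `U`. Its values off `ψ(U)` play no role. -/
def IsGeneratingFunction (F : Cotangent n M → Cotangent n M) (U : Set (Cotangent n M))
    (S : M × M → ℝ) : Prop :=
  IsPrimitive F U (fun x => S (psi F x))

/-! ### Linking of spheres -/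

/-- Singular homology `H_k(X; ℤ)`. -/
abbrev Homology (k : ℕ) (X : Type u) [TopologicalSpace X] : ModuleCat.{u} ℤ :=
  ((AlgebraicTopology.singularHomologyFunctor (ModuleCat.{u} ℤ) k).obj
    (ModuleCat.of ℤ (ULift.{u} ℤ))).obj (TopCat.of X)

/-- The map `f_*` induced on `H_k` by a continuous map `f`. -/
def Homology.push (k : ℕ) {X Y : Type u} [TopologicalSpace X] [TopologicalSpace Y] (f : C(X, Y)) :
    Homology k X →ₗ[ℤ] Homology k Y :=
  (((AlgebraicTopology.singularHomologyFunctor (ModuleCat.{u} ℤ) k).obj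
    (ModuleCat.of ℤ (ULift.{u} ℤ))).map (TopCat.ofHom f)).hom

/-- Reduced homology, as the kernel of the map induced by `X → point`. It differs from `H_k` for
`k = 0` only. -/
def reducedHomology (k : ℕ) (X : Type u) [TopologicalSpace X] : Submodule ℤ (Homology k X) :=
  LinearMap.ker (Homology.push k (ContinuousMap.const X PUnit.unit.{u + 1}))

/-- `a` generates the reduced homology of `X` in degree `k`. For a `k`-dimensional sphere `X`, this
means that `a` is one of its two fundamental classes. -/
def IsFundamentalClass {k : ℕ} {X : Type u} [TopologicalSpace X] (a : Homology k X) : Prop :=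
  Submodule.span ℤ {a} = reducedHomology k X

/-- A trivializing neighborhood `E` of the disk bundle, over an open set `base` which contains `q`
and is homeomorphic to `ℝⁿ`. -/
structure TrivializingNhd (g : RiemMetric n M) (C : ℝ) (q : M) where
  base : Set M
  isOpen_base : IsOpen base
  mem_base : q ∈ base
  chart : base ≃ₜ Eucl n
  triv : {x : Cotangent n M | x ∈ diskBundle g C ∧ proj x ∈ base} ≃ₜ
    base × Metric.closedBall (0 : Eucl n) 1
  triv_fst : ∀ x, ((triv x).1 : M) = proj x.1
  triv_boundary : ∀ x, x.1 ∈ sphereBundle g C ↔ ‖((triv x).2 : Eucl n)‖ = 1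

namespace TrivializingNhd

variable {g : RiemMetric n M} {C : ℝ} {q : M}

/-- `E`, as a subset of `B*M`. -/
def total (E : TrivializingNhd g C q) : Set (Cotangent n M) :=
  {x | x ∈ diskBundle g C ∧ proj x ∈ E.base}

/-- `∂E ∖ ∂Δ_q`, where `∂E` is the part of `∂B*M` in `E`. -/
def punctured (E : TrivializingNhd g C q) : Set (Cotangent n M) :=
  {x | x ∈ E.total ∧ x ∈ sphereBundle g C} \ sphereFiber g C q

/-- The trivialization restricts to `∂E ∖ ∂Δ_q ≅ (base ∖ {q}) × Sⁿ⁻¹ ≅ (ℝⁿ ∖ {0}) × Sⁿ⁻¹`; this is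
its first component. -/
def toFirst (E : TrivializingNhd g C q) : C(E.punctured, (E.base \ {q} : Set M)) where
  toFun x := ⟨((E.triv ⟨x.1, x.2.1.1⟩).1 : M), (E.triv ⟨x.1, x.2.1.1⟩).1.2, fun h =>
    x.2.2 ⟨x.2.1.2, (E.triv_fst ⟨x.1, x.2.1.1⟩).symm.trans h⟩⟩
  continuous_toFun := by
    refine Continuous.subtype_mk (continuous_subtype_val.comp (continuous_fst.comp
      (E.triv.continuous.comp ?_))) _
    exact Continuous.subtype_mk continuous_subtype_val _

end TrivializingNhd

/-- The sphere `∂Δ_q` links with its image `F(∂Δ_q)` in `∂B*M`: in some trivializing neighborhood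
`E`, which contains `Δ_q` and `F(Δ_q)`, the sphere `F(∂Δ_q)` lies in `∂E ∖ ∂Δ_q`, and its class in
`H_{n-1}(∂E ∖ ∂Δ_q) ≅ H_{n-1}((ℝⁿ ∖ {0}) × Sⁿ⁻¹) ≅ H_{n-1}(ℝⁿ ∖ {0}) ⊕ H_{n-1}(Sⁿ⁻¹)` has a nonzero
component in the first summand. That component is the image under the first projection. (For
`n = 1`, where homology is taken reduced, the class is that of the difference of the two points.) -/
def SpheresLink (g : RiemMetric n M) (C : ℝ) (F : Cotangent n M → Cotangent n M) (q : M) : Prop :=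
  ∃ E : TrivializingNhd g C q, MapsTo F (diskFiber g C q) E.total ∧
    ∃ f : C(sphereFiber g C q, E.punctured), (∀ x, (f x : Cotangent n M) = F x) ∧
      ∃ a : Homology (n - 1) (sphereFiber g C q), IsFundamentalClass a ∧
        Homology.push (n - 1) E.toFirst (Homology.push (n - 1) f a) ≠ 0

end TwistMap

end

/-! A fixed point of `F` is in particular a point that `ψ` sends to the diagonal, so the proof
determines all such points. Linking gives one over each `q`: if `F(Δ_q)` missed the fiber over `q`,
then `π ∘ F` on `∂Δ_q` would extend over the contractible disk `Δ_q` as a map into `base ∖ {q}`, and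
would kill the reduced class (`SpheresLink.exists_mem_diskFiber`). This point `σ(q)` is unique
because `ψ` is injective, and it is interior because `∂Δ_q` is disjoint from its image.

Since `ψ ∘ σ` is the diagonal map, `σ` is continuous (`ψ` is a topological embedding), then smooth
(`ψ` is an immersion between manifolds of dimension `2n`); this is `exists_section`. Both `σ` and `F
∘ σ` are sections of `T*M`, so pulling `F^* p dq - p dq = dS` back by `σ` gives `d(S(q,q)) = P - p`
with `(q,p) = σ(q)` and `(q,P) = F(σ(q))`. It vanishes exactly when `σ(q)` is fixed, and every fixed
point lies on `σ`. -/

namespace TwistMap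

/-! ### Singular homology -/

section Homology

variable {X Y Z : Type u} [TopologicalSpace X] [TopologicalSpace Y] [TopologicalSpace Z]

theorem Homology.push_comp (k : ℕ) (f : C(X, Y)) (h : C(Y, Z)) (a : Homology k X) :
    Homology.push k (h.comp f) a = Homology.push k h (Homology.push k f a) := by
  simp only [Homology.push, TopCat.ofHom_comp, Functor.map_comp, ModuleCat.hom_comp,
    LinearMap.comp_apply]

theorem Homology.push_eq_of_homotopic (k : ℕ) {f h : C(X, Y)} (H : f.Homotopic h) :
    Homology.push k f = Homology.push k h := by
  obtain ⟨H⟩ := H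
  have := TopCat.Homotopy.congr_homologyMap_singularChainComplexFunctor
    (f := TopCat.ofHom f) (g := TopCat.ofHom h) H (ModuleCat.of ℤ (ULift.{u} ℤ)) k
  exact congrArg ModuleCat.Hom.hom this

/-- A nullhomotopic map kills reduced homology. -/
theorem Homology.push_eq_zero_of_nullhomotopic (k : ℕ) {f : C(X, Y)} (H : f.Nullhomotopic)
    {a : Homology k X} (ha : a ∈ reducedHomology k X) : Homology.push k f a = 0 := by
  obtain ⟨y, H⟩ := H
  rw [Homology.push_eq_of_homotopic k H]
  -- A constant map factors through a point, where a reduced class already vanishes.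
  have : ContinuousMap.const X y =
      (ContinuousMap.const PUnit.{u + 1} y).comp (ContinuousMap.const X PUnit.unit) := rfl
  rw [this, Homology.push_comp, LinearMap.mem_ker.1 ha, map_zero]

end Homology

/-! ### Smoothness of continuous lifts through local diffeomorphisms -/

section Lift

variable {E : Type*} [NormedAddCommGroup E] [NormedSpace ℝ E] [FiniteDimensional ℝ E]
  {H : Type*} [TopologicalSpace H] {I : ModelWithCorners ℝ E H} [I.Boundaryless]
  {X : Type*} [TopologicalSpace X] [ChartedSpace H X]
  {E' : Type*} [NormedAddCommGroup E'] [NormedSpace ℝ E'] [FiniteDimensional ℝ E']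
  {H' : Type*} [TopologicalSpace H'] {J : ModelWithCorners ℝ E' H'}
  {Y : Type*} [TopologicalSpace Y] [ChartedSpace H' Y]
  {E'' : Type*} [NormedAddCommGroup E''] [NormedSpace ℝ E'']
  {H'' : Type*} [TopologicalSpace H''] {K : ModelWithCorners ℝ E'' H''}
  {Z : Type*} [TopologicalSpace Z] [ChartedSpace H'' Z]

/-- A continuous map `s` is smooth if its composition with an immersion between manifolds of the
same dimension is smooth. -/
theorem contMDiffAt_of_comp_of_injective_mfderiv {m : ℕ∞ω} (hm : m ≠ 0)
    [IsManifold I m X] [IsManifold J m Y]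
    {f : X → Y} {s : Z → X} {z : Z} (hf : ContMDiffAt I J m f (s z)) (hs : ContinuousAt s z)
    (hfs : ContMDiffAt K J m (f ∘ s) z)
    (hinj : Function.Injective (mfderiv I J f (s z)))
    (hdim : Module.finrank ℝ E = Module.finrank ℝ E') : ContMDiffAt K I m s z := by
  have hφ : ContDiffAt ℝ m (writtenInExtChartAt I J (s z) f) (extChartAt I (s z) (s z)) := by
    have := (contMDiffAt_iff.1 hf).2
    rwa [I.range_eq_univ, contDiffWithinAt_univ] at this
  let D : E →L[ℝ] E' := mfderiv I J f (s z)
  have hder : HasFDerivAt (writtenInExtChartAt I J (s z) f) D (extChartAt I (s z) (s z)) := by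
    have h : HasFDerivWithinAt (writtenInExtChartAt I J (s z) f) D (range I)
        (extChartAt I (s z) (s z)) := (hf.mdifferentiableAt hm).hasMFDerivAt.2
    rwa [I.range_eq_univ, hasFDerivWithinAt_univ] at h
  -- Equal dimensions make the injective derivative invertible, so the inverse function theorem
  -- applies in charts.
  let L : E ≃L[ℝ] E' :=
    (LinearEquiv.ofInjectiveOfFinrankEq (D : E →ₗ[ℝ] E') hinj hdim).toContinuousLinearEquiv
  have hL : (L : E →L[ℝ] E') = D := rfl
  rw [← hL] at hder
  let P := hφ.toOpenPartialHomeomorph _ hder hm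
  have hP : ContDiffAt ℝ m P.symm
      (writtenInExtChartAt I J (s z) f (extChartAt I (s z) (s z))) :=
    hφ.to_localInverse hder hm
  have hval : writtenInExtChartAt I J (s z) f (extChartAt I (s z) (s z)) =
      extChartAt J (f (s z)) (f (s z)) := by
    simp [writtenInExtChartAt]
  rw [hval] at hP
  refine contMDiffAt_iff_target.2 ⟨hs, ?_⟩
  have hsm : ContMDiffAt K 𝓘(ℝ, E) m
      (P.symm ∘ (extChartAt J (f (s z)) ∘ (f ∘ s))) z :=
    hP.contMDiffAt.comp z (contMDiffAt_iff_target.1 hfs).2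
  -- Continuity of `s` keeps it in the domain of the local inverse near `z`; there `s`, read in the
  -- chart, is this inverse applied to `f ∘ s`.
  refine hsm.congr_of_eventuallyEq ?_
  have h1 : ∀ᶠ w in nhds z, s w ∈ (extChartAt I (s z)).source :=
    hs.eventually (extChartAt_source_mem_nhds (s z))
  have h2 : ∀ᶠ w in nhds z, extChartAt I (s z) (s w) ∈ P.source :=
    ((continuousAt_extChartAt (I := I) (s z)).comp hs).eventually
      (P.open_source.mem_nhds (hφ.mem_toOpenPartialHomeomorph_source hder hm))
  filter_upwards [h1, h2] with w hw1 hw2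
  have := P.left_inv hw2
  have h3 : P (extChartAt I (s z) (s w)) = extChartAt J (f (s z)) (f (s w)) := by
    change writtenInExtChartAt I J (s z) f _ = _
    rw [writtenInExtChartAt, Function.comp_apply, Function.comp_apply,
      (extChartAt I (s z)).left_inv hw1]
  rw [h3] at this
  exact this.symm

end Lift

end TwistMap

namespace TwistMap

variable {n : ℕ} {M : Type u} [TopologicalSpace M] [ChartedSpace (Eucl n) M]
  [IsManifold (𝓡 n) ∞ M]

/-! ### The disk bundle -/

section Disk

variable (g : RiemMetric n M)

theorem inner_sq_le (q : M) (v w : TangentSpace (𝓡 n) q) :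
    g.inner q v w ^ 2 ≤ g.inner q v v * g.inner q w w := by
  let B : LinearMap.BilinForm ℝ (TangentSpace (𝓡 n) q) :=
    (ContinuousLinearMap.coeLM ℝ).comp (g.inner q : TangentSpace (𝓡 n) q →ₗ[ℝ] _)
  refine B.apply_sq_le_of_symm (fun v => ?_) ⟨fun v w => g.symm q v w⟩ v w
  rcases eq_or_ne v 0 with rfl | hv
  · simp
  · exact (g.pos q v hv).le

/-- Positive definiteness makes `v ↦ g(v, ·)` injective, hence surjective onto the dual by dimension
count. -/
theorem exists_eq_inner (q : M) (p : TangentSpace (𝓡 n) q →L[ℝ] ℝ) :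
    ∃ v, p = g.inner q v := by
  let T : Eucl n →ₗ[ℝ] (Eucl n →L[ℝ] ℝ) :=
    (g.inner q : TangentSpace (𝓡 n) q →ₗ[ℝ] (TangentSpace (𝓡 n) q →L[ℝ] ℝ))
  have hinj : Function.Injective T := by
    refine (injective_iff_map_eq_zero T).2 fun v hv => ?_
    by_contra h
    have h1 := g.pos q v h
    have h2 : g.inner q v v = 0 := congrArg (fun l : Eucl n →L[ℝ] ℝ => l v) hv
    exact h1.ne' h2
  have hdim : Module.finrank ℝ (Eucl n) = Module.finrank ℝ (Eucl n →L[ℝ] ℝ) := by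
    rw [← (LinearMap.toContinuousLinearMap (𝕜 := ℝ) (E := Eucl n) (F' := ℝ)).finrank_eq]
    exact (Subspace.dual_finrank_eq (K := ℝ) (V := Eucl n)).symm
  obtain ⟨v, hv⟩ := (LinearMap.injective_iff_surjective_of_finrank_eq_finrank hdim).1 hinj p
  exact ⟨v, hv.symm⟩

/-- Test the bound on the vector representing the covector. This dual description of the disk avoids
following that vector as the base point moves. -/
theorem mem_diskBundle_of_forall {C : ℝ} {x : Cotangent n M}
    (h : ∀ w, covector x w ^ 2 ≤ C ^ 2 * g.inner (proj x) w w) : x ∈ diskBundle g C := by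
  obtain ⟨v, hv⟩ := exists_eq_inner g (proj x) (covector x)
  refine ⟨v, hv, ?_⟩
  have := h v
  rw [hv, sq] at this
  rcases eq_or_ne v 0 with rfl | hv0
  · simpa using sq_nonneg C
  · exact le_of_mul_le_mul_right this (g.pos _ v hv0)

/-- Off the boundary, Cauchy–Schwarz makes the bound `p(w)² ≤ C² g(w, w)` strict for `w ≠ 0`.
Compactness of the unit sphere in a local trivialization preserves it at nearby points, and
homogeneity extends it to all `w`. -/
theorem diskBundle_mem_nhds {C : ℝ} {x : Cotangent n M} (hx : x ∈ diskBundle g C)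
    (hx' : x ∉ sphereBundle g C) : diskBundle g C ∈ nhds x := by
  obtain ⟨v, hv, hvC⟩ := hx
  replace hvC : g.inner (proj x) v v < C ^ 2 := lt_of_le_of_ne hvC fun h => hx' ⟨v, hv, h⟩
  let e := trivializationAt (Eucl n) (TangentSpace (𝓡 n) : M → Type _) (proj x)
  have hbase : proj x ∈ e.baseSet := FiberBundle.mem_baseSet_trivializationAt' (proj x)
  have hπ : Continuous (proj : Cotangent n M → M) :=
    FiberBundle.continuous_proj (Eucl n →L[ℝ] ℝ)
      (fun q : M => TangentSpace (𝓡 n) q →L[ℝ] Bundle.Trivial M ℝ q)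
  have hsymm (w : Eucl n) : ContinuousAt (fun z : Cotangent n M × Eucl n =>
      (⟨proj z.1, e.symm (proj z.1) z.2⟩ : TangentBundle (𝓡 n) M)) (x, w) := by
    have h1 := (e.continuousOn_symm).continuousAt (x := (proj x, w))
      ((e.open_baseSet.prod isOpen_univ).mem_nhds ⟨hbase, mem_univ _⟩)
    exact ContinuousAt.comp (x := (x, w)) (f := fun z : Cotangent n M × Eucl n => (proj z.1, z.2)) h1
      ((hπ.comp continuous_fst).prodMk continuous_snd).continuousAt
  have hcov (w : Eucl n) : ContinuousAt (fun z : Cotangent n M × Eucl n =>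
      covector z.1 (e.symm (proj z.1) z.2)) (x, w) := by
    have h1 := ContinuousAt.clm_bundle_apply (𝕜 := ℝ) (F₁ := Eucl n) (F₂ := ℝ)
      (E₁ := (TangentSpace (𝓡 n) : M → Type _)) (E₂ := Bundle.Trivial M ℝ)
      (b := fun z : Cotangent n M × Eucl n => proj z.1) (ϕ := fun z => covector z.1)
      (x := (x, w)) continuous_fst.continuousAt (hsymm w)
    exact (Bundle.Trivial.homeomorphProd M ℝ).continuous.snd.continuousAt.comp h1
  have hmet (w : Eucl n) : ContinuousAt (fun z : Cotangent n M × Eucl n =>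
      g.inner (proj z.1) (e.symm (proj z.1) z.2) (e.symm (proj z.1) z.2)) (x, w) := by
    have h1 := ContinuousAt.clm_bundle_apply₂ (𝕜 := ℝ) (F₁ := Eucl n) (F₂ := Eucl n) (F₃ := ℝ)
      (E₁ := (TangentSpace (𝓡 n) : M → Type _)) (E₂ := (TangentSpace (𝓡 n) : M → Type _))
      (E₃ := Bundle.Trivial M ℝ)
      (b := fun z : Cotangent n M × Eucl n => proj z.1) (ψ := fun z => g.inner (proj z.1))
      (x := (x, w)) ((g.contMDiff.continuous.comp (hπ.comp continuous_fst)).continuousAt)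
      (hsymm w) (hsymm w)
    exact (Bundle.Trivial.homeomorphProd M ℝ).continuous.snd.continuousAt.comp h1
  have hnhds : ∀ᶠ y in nhds x, ∀ w ∈ Metric.sphere (0 : Eucl n) 1,
      covector y (e.symm (proj y) w) ^ 2 ≤
        C ^ 2 * g.inner (proj y) (e.symm (proj y) w) (e.symm (proj y) w) := by
    refine (isCompact_sphere (0 : Eucl n) 1).eventually_forall_of_forall_eventually
      fun w hw => ?_
    refine (((hcov w).pow 2).eventually_lt (continuousAt_const.mul (hmet w)) ?_).mono
      fun _ h => h.le
    have hw0 : w ≠ 0 := ne_zero_of_mem_unit_sphere ⟨w, hw⟩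
    have hw1 : e.symm (proj x) w ≠ 0 := by
      intro h
      apply hw0
      have := (e.continuousLinearEquivAt ℝ _ hbase).symm.map_eq_zero_iff (x := w)
      exact this.1 h
    have h1 := g.pos (proj x) _ hw1
    have h2 := inner_sq_le g (proj x) v (e.symm (proj x) w)
    simp only [Pi.pow_apply, Pi.mul_apply]
    rw [hv]
    nlinarith
  filter_upwards [hnhds, hπ.continuousAt.eventually (e.open_baseSet.mem_nhds hbase)]
    with y hy hyb
  refine mem_diskBundle_of_forall g fun w => ?_
  rcases eq_or_ne w 0 with rfl | hw
  · simp
  let L := e.continuousLinearEquivAt ℝ _ hyb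
  have hLw : L w ≠ 0 := by simpa using hw
  have hn : ‖L w‖ ≠ 0 := norm_ne_zero_iff.2 hLw
  -- Both sides are quadratic in `w`, so it suffices to treat `w` rescaled to unit length in the
  -- trivialization.
  have h1 := hy (‖L w‖⁻¹ • L w) (by simp [norm_smul, hn])
  have h2 : e.symm (proj y) (‖L w‖⁻¹ • L w) = ‖L w‖⁻¹ • w := by
    change L.symm _ = _
    simp
  rw [h2] at h1
  simp only [map_smul, smul_apply, smul_eq_mul] at h1
  have h3 : 0 < (‖L w‖⁻¹) ^ 2 := by positivity
  refine le_of_mul_le_mul_left ?_ h3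
  linarith

/-- The fiber `Δ_q` is contractible. -/
theorem contractibleSpace_diskFiber {C : ℝ} {q : M} (E : TrivializingNhd g C q) :
    ContractibleSpace (diskFiber g C q) := by
  have hmem (x : diskFiber g C q) : proj x.1 ∈ E.base := by
    rw [x.2.2]
    exact E.mem_base
  -- The trivialization, restricted to the fiber over `q`, identifies it with the closed unit ball.
  let φ : diskFiber g C q ≃ₜ Metric.closedBall (0 : Eucl n) 1 :=
    { toFun x := (E.triv ⟨x.1, x.2.1, hmem x⟩).2
      invFun v := ⟨(E.triv.symm (⟨q, E.mem_base⟩, v)).1, (E.triv.symm (⟨q, E.mem_base⟩, v)).2.1,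
        by rw [← E.triv_fst, E.triv.apply_symm_apply]⟩
      left_inv x := by
        have h : E.triv ⟨x.1, x.2.1, hmem x⟩ =
            (⟨q, E.mem_base⟩, (E.triv ⟨x.1, x.2.1, hmem x⟩).2) :=
          Prod.ext (Subtype.ext ((E.triv_fst _).trans x.2.2)) rfl
        ext1
        dsimp only
        rw [← h, E.triv.symm_apply_apply]
      right_inv v := by simp
      continuous_toFun := continuous_snd.comp (E.triv.continuous.comp
        (continuous_subtype_val.subtype_mk _))
      continuous_invFun := (continuous_subtype_val.comp (E.triv.symm.continuous.comp
        (continuous_const.prodMk continuous_id))).subtype_mk _ }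
  have : ContractibleSpace (Metric.closedBall (0 : Eucl n) 1) :=
    (convex_closedBall _ _).contractibleSpace ⟨0, by simp⟩
  exact φ.contractibleSpace

end Disk

end TwistMap

namespace TwistMap

variable {n : ℕ} {M : Type u} [TopologicalSpace M] [ChartedSpace (Eucl n) M]
  [IsManifold (𝓡 n) ∞ M]

section Fixed

variable {g : RiemMetric n M} {C : ℝ} {F : Cotangent n M → Cotangent n M} {q : M}

/-! ### Consequences of linking -/

/-- This is the disjointness half of linking: otherwise `F x` would lie on `∂Δ_q`, which
`E.punctured` excludes. -/
theorem SpheresLink.not_proj_eq (h : SpheresLink g C F q) {x : Cotangent n M}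
    (hx : x ∈ sphereFiber g C q) : proj (F x) ≠ q := by
  obtain ⟨E, -, f, hf, -⟩ := h
  intro hq
  have := (f ⟨x, hx⟩).2
  rw [hf] at this
  exact this.2 ⟨this.1.2, hq⟩

/-- If `∂Δ_q` links with its image then `F(Δ_q)` meets the fiber over `q`: otherwise the class of
`F(∂Δ_q)` would come from the contractible disk `Δ_q`. -/
theorem SpheresLink.exists_mem_diskFiber (h : SpheresLink g C F q)
    (hF : ContinuousOn F (diskBundle g C)) : ∃ x ∈ diskFiber g C q, proj (F x) = q := by
  obtain ⟨E, hE, f, hf, a, ha, hne⟩ := h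
  by_contra! hno
  apply hne
  have hπ : Continuous (proj : Cotangent n M → M) :=
    FiberBundle.continuous_proj (Eucl n →L[ℝ] ℝ)
      (fun q : M => TangentSpace (𝓡 n) q →L[ℝ] Bundle.Trivial M ℝ q)
  have hsub : sphereFiber g C q ⊆ diskFiber g C q := by
    rintro x ⟨⟨v, hv, hvC⟩, hq⟩
    exact ⟨⟨v, hv, hvC.le⟩, hq⟩
  let i : C(sphereFiber g C q, diskFiber g C q) := ⟨inclusion hsub, continuous_inclusion hsub⟩
  have hFc : Continuous fun x : diskFiber g C q => proj (F x) :=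
    hπ.comp ((hF.mono fun x hx => hx.1).comp_continuous continuous_subtype_val fun x => x.2)
  let e : C(diskFiber g C q, (E.base \ {q} : Set M)) :=
    ⟨fun x => ⟨proj (F x), (hE x.2).2, hno x x.2⟩, hFc.subtype_mk _⟩
  have hfac : E.toFirst.comp f = e.comp i := by
    ext x
    -- The first component of the trivialization is `π`, so the linking map is `π ∘ F` on the
    -- sphere, which extends over the disk.
    exact (E.triv_fst _).trans (congrArg proj (hf x))
  have := contractibleSpace_diskFiber g E
  have hnull : (e.comp i).Nullhomotopic := by
    have := ((id_nullhomotopic (diskFiber g C q)).comp_left i).comp_right e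
    exact this
  rw [← Homology.push_comp, hfac]
  refine Homology.push_eq_zero_of_nullhomotopic _ hnull ?_
  have ha' : a ∈ Submodule.span ℤ {a} := Submodule.mem_span_singleton_self a
  rwa [ha] at ha'

/-! ### Exact symplectic maps and sections of the cotangent bundle -/

theorem eq_of_proj_eq_of_covector_eq {x y : Cotangent n M} (h : proj x = proj y)
    (hc : (covector x : Eucl n →L[ℝ] ℝ) = covector y) : x = y := by
  obtain ⟨q, p⟩ := x
  obtain ⟨q', p'⟩ := y
  obtain rfl : q = q' := h
  exact congrArg (TotalSpace.mk q) hc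

theorem contMDiff_proj' : ContMDiff (cotModel n) (𝓡 n) ∞ (proj : Cotangent n M → M) :=
  Bundle.contMDiff_proj (fun q : M => TangentSpace (𝓡 n) q →L[ℝ] Bundle.Trivial M ℝ q)

/-- The pullback of the canonical form by a map `τ` over the identity has the values of `τ`. -/
theorem canonicalForm_mfderiv {τ : M → Cotangent n M} {q : M}
    (hτ : MDifferentiableAt (𝓡 n) (cotModel n) τ q)
    (hid : ∀ q, proj (τ q) = q) (v : Eucl n) :
    canonicalForm (τ q) (mfderiv (𝓡 n) (cotModel n) τ q v) =
      (covector (τ q) : Eucl n →L[ℝ] ℝ) v := by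
  have h1 := mfderiv_comp_apply (I'' := 𝓡 n) (f := τ) (g := (proj : Cotangent n M → M)) q
    ((contMDiff_proj' (τ q)).mdifferentiableAt (by simp)) hτ v
  have h2 : (proj : Cotangent n M → M) ∘ τ = id := funext hid
  have h3 : mfderiv (cotModel n) (𝓡 n) (proj : Cotangent n M → M) (τ q)
      (mfderiv (𝓡 n) (cotModel n) τ q v) = v := by
    rw [← h1, h2, mfderiv_id]
    rfl
  exact congrArg (covector (τ q) : Eucl n →L[ℝ] ℝ) h3

/-- If `F^* p dq - p dq = dT` near the image of a section `σ` of `T*M`, and `F ∘ σ` is a section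
too, then `d(T ∘ σ) = F ∘ σ - σ`. -/
theorem IsPrimitive.mfderiv_comp_section {U : Set (Cotangent n M)} {T : Cotangent n M → ℝ}
    (hT : IsPrimitive F U T) (hF : ContMDiffOn (cotModel n) (cotModel n) ∞ F U)
    {σ : M → Cotangent n M} (hσ : ContMDiff (𝓡 n) (cotModel n) ∞ σ)
    (hU : ∀ q, U ∈ nhds (σ q)) (hid : ∀ q, proj (σ q) = q) (hFid : ∀ q, proj (F (σ q)) = q)
    (q : M) (v : Eucl n) :
    mfderiv (𝓡 n) 𝓘(ℝ, ℝ) (T ∘ σ) q v =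
      (covector (F (σ q)) : Eucl n →L[ℝ] ℝ) v - (covector (σ q) : Eucl n →L[ℝ] ℝ) v := by
  have hσq := (hσ q).mdifferentiableAt (by simp)
  have hFq := (hF.contMDiffAt (hU q)).mdifferentiableAt (by simp)
  have hTq := (hT.1.contMDiffAt (hU q)).mdifferentiableAt (by simp)
  have h1 := hT.2 (σ q) (mem_of_mem_nhds (hU q)) (mfderiv (𝓡 n) (cotModel n) σ q v)
  rw [mfderivWithin_of_mem_nhds (hU q), mfderivWithin_of_mem_nhds (hU q)] at h1
  have h2 : canonicalForm (F (σ q)) (mfderiv (cotModel n) (cotModel n) F (σ q)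
      (mfderiv (𝓡 n) (cotModel n) σ q v)) = (covector (F (σ q)) : Eucl n →L[ℝ] ℝ) v :=
    (congrArg (canonicalForm (F (σ q))) (mfderiv_comp_apply q hFq hσq v)).symm.trans
      (canonicalForm_mfderiv (τ := F ∘ σ) (hFq.comp q hσq) hFid v)
  have h3 := canonicalForm_mfderiv hσq hid v
  exact ((mfderiv_comp_apply q hTq hσq v).trans h1.symm).trans
    (congrArg₂ (fun a b : ℝ => a - b) h2 h3)

theorem finrank_cotModel : Module.finrank ℝ (Eucl n × (Eucl n →L[ℝ] ℝ)) =
    Module.finrank ℝ (Eucl n × Eucl n) := by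
  rw [Module.finrank_prod, Module.finrank_prod,
    ← (LinearMap.toContinuousLinearMap (𝕜 := ℝ) (E := Eucl n) (F' := ℝ)).finrank_eq]
  exact congrArg _ (Subspace.dual_finrank_eq (K := ℝ) (V := Eucl n))

/-- The points that `ψ` sends to the diagonal form a smooth section of `T*M` in the interior of
the disk bundle. -/
theorem exists_section (hF : IsSymplecticTwistMap F (diskBundle g C))
    (hlink : ∀ q : M, SpheresLink g C F q) :
    ∃ σ : M → Cotangent n M, ContMDiff (𝓡 n) (cotModel n) ∞ σ ∧
      (∀ q, diskBundle g C ∈ nhds (σ q)) ∧ ∀ q, psi F (σ q) = (q, q) := by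
  choose σ hσ hFσ using fun q => (hlink q).exists_mem_diskFiber hF.contMDiffOn.continuousOn
  -- Being interior lets derivatives within the disk bundle be replaced by ordinary ones.
  have hU (q : M) : diskBundle g C ∈ nhds (σ q) :=
    diskBundle_mem_nhds g (hσ q).1 fun h => (hlink q).not_proj_eq ⟨h, (hσ q).2⟩ (hFσ q)
  have hψ (q : M) : psi F (σ q) = (q, q) := Prod.ext (hσ q).2 (hFσ q)
  have hdiag : psi F ∘ σ = fun q => (q, q) := funext hψ
  have hcont : Continuous σ := by
    have : Continuous fun q => (⟨σ q, (hσ q).1⟩ : diskBundle g C) := by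
      rw [hF.isEmbedding_psi.continuous_iff]
      exact (continuous_id.prodMk continuous_id).congr fun q => (hψ q).symm
    exact continuous_subtype_val.comp this
  refine ⟨σ, fun q => ?_, hU, hψ⟩
  have hπ := contMDiff_proj' (n := n) (M := M)
  have hψs : ContMDiffAt (cotModel n) ((𝓡 n).prod (𝓡 n)) ∞ (psi F) (σ q) :=
    (hπ _).prodMk ((hπ _).comp (σ q) (hF.contMDiffOn.contMDiffAt (hU q)))
  refine contMDiffAt_of_comp_of_injective_mfderiv (by simp) hψs hcont.continuousAt ?_ ?_
    finrank_cotModel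
  · rw [hdiag]
    exact contMDiffAt_id.prodMk contMDiffAt_id
  · have := hF.immersion_psi (σ q) (hσ q).1
    rwa [mfderivWithin_of_mem_nhds (hU q)] at this

end Fixed

end TwistMap

/-! ### Fixed points and critical points -/

theorem theorem3 {n : ℕ} (hn : 1 ≤ n) {M : Type u} [TopologicalSpace M] [T2Space M]
    [CompactSpace M] [ChartedSpace (TwistMap.Eucl n) M] [IsManifold (𝓡 n) ∞ M]
    (g : TwistMap.RiemMetric n M) {C : ℝ} (hC : 0 < C)
    (F : TwistMap.Cotangent n M → TwistMap.Cotangent n M)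
    (hF : TwistMap.IsSymplecticTwistMap F (TwistMap.diskBundle g C))
    (hlink : ∀ q : M, TwistMap.SpheresLink g C F q)
    (S : M × M → ℝ)
    (hS : TwistMap.IsGeneratingFunction F (TwistMap.diskBundle g C) S) :
    -- the function `q ↦ S (q, q)` makes sense on all of `M`
    (∀ q : M, (q, q) ∈ TwistMap.psi F '' TwistMap.diskBundle g C) ∧
    -- it is smooth
    ContMDiff (𝓡 n) 𝓘(ℝ, ℝ) ∞ (fun q : M => S (q, q)) ∧
    -- its critical points are the fixed points of `F`, through the projection
    BijOn TwistMap.proj {x | x ∈ TwistMap.diskBundle g C ∧ F x = x}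
      {q : M | mfderiv (𝓡 n) 𝓘(ℝ, ℝ) (fun q : M => S (q, q)) q = 0} := by
  obtain ⟨σ, hσ, hU, hψ⟩ := TwistMap.exists_section hF hlink
  have hσU (q : M) : σ q ∈ TwistMap.diskBundle g C := mem_of_mem_nhds (hU q)
  have hid (q : M) : TwistMap.proj (σ q) = q := congrArg Prod.fst (hψ q)
  have hFid (q : M) : TwistMap.proj (F (σ q)) = q := congrArg Prod.snd (hψ q)
  have hSσ : (fun q : M => S (q, q)) = (fun x => S (TwistMap.psi F x)) ∘ σ :=
    funext fun q => congrArg S (hψ q).symm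
  have hder := hS.mfderiv_comp_section hF.contMDiffOn hσ hU hid hFid
  rw [← hSσ] at hder
  have hinj : InjOn (TwistMap.psi F) (TwistMap.diskBundle g C) :=
    injOn_iff_injective.2 hF.isEmbedding_psi.injective
  -- A fixed point has the same image under `ψ` as the point of `σ` over the same `q`, namely `(q,
  -- q)`.
  have hfix {x : TwistMap.Cotangent n M} (hx : x ∈ TwistMap.diskBundle g C) (hFx : F x = x) :
      x = σ (TwistMap.proj x) :=
    hinj hx (hσU _) (by rw [hψ, TwistMap.psi, hFx])
  have hcrit (q : M) : mfderiv (𝓡 n) 𝓘(ℝ, ℝ) (fun q : M => S (q, q)) q = 0 ↔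
      F (σ q) = σ q := by
    constructor
    · intro h
      refine TwistMap.eq_of_proj_eq_of_covector_eq ((hFid q).trans (hid q).symm)
        (ContinuousLinearMap.ext fun v => sub_eq_zero.1 ?_)
      refine (hder q v).symm.trans ?_
      rw [h]
      rfl
    · intro h
      refine ContinuousLinearMap.ext fun v => (hder q v).trans ?_
      rw [h]
      exact sub_self _
  refine ⟨fun q => ⟨σ q, hσU q, hψ q⟩, fun q => ?_, ?_, ?_, ?_⟩
  · rw [hSσ]
    exact (hS.1.contMDiffAt (hU q)).comp q (hσ q)
  · rintro x ⟨hx, hFx⟩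
    refine (hcrit _).2 ?_
    rw [← hfix hx hFx, hFx]
  · rintro x ⟨hx, hFx⟩ y ⟨hy, hFy⟩ hxy
    rw [hfix hx hFx, hfix hy hFy, hxy]
  · intro q hq
    exact ⟨σ q, ⟨hσU q, (hcrit q).1 hq⟩, hid q⟩
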